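/- Let $\mathbb K$ be a field of characteristic $0$, let $I$ be a finite set with $n=|I|$, and let $\ell$ be a linear order $\ell_1<\ell_2<\dots<\ell_n$ on $I$. Let $\mathbb R I$ be the real vector space with basis $(e_i)_{i\in I}$. Definitions. A generalized permutahedron in $\mathbb R I$ is a polytope whose normal fan is a coarsening of the normal fan of the standard permutahedron $\pi_I=\operatorname{conv}\{\sum_{i} f(i)e_i : f:I\to\{1,\dots,n\}\text{ a bijection}\}$; two are normally equivalent if they have the same normal fan. $\overline{\mathbf{GP}}[I]$ is the $\mathbb K$-vector space with basis the normal equivalence classes of generalized permutahedra in $\mathbb R I$, and $\mathbf P[I]$ is the $\mathbb K$-vector space with basis the partial orders on $I$. For a vertex $v$ of a polytope $P$, the vertex cone $\operatorname{cone}_v(P)$ is generated by the directions of the edges of $P$ with endpoint $v$, pointing away from $v$; for a partial order $p$ on $I$, $\operatorname{cone}(p)$ is generated by the vectors $e_i-e_j$ with $i\ge j$ in $p$. If $P$ is a generalized permutahedron, $\operatorname{poset}_v(P)$ is the partial order $p$ corresponding to the vertex cone, i.e. $\operatorname{cone}(p)=\operatorname{cone}_v(P)$; equivalently, $i\ge j$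 in $p$ if and only if $e_i-e_j\in\operatorname{cone}_v(P)$. The Brion map $B:\overline{\mathbf{GP}}[I]\to\mathbf P[I]$ is the (well-defined) linear map with $B(P)=\sum_{v\text{ vertex of }P}\operatorname{poset}_v(P)$. The Loday associahedron is the Minkowski sum $a_\ell=\sum_{i\le_\ell j}\operatorname{conv}\{e_k : i\le_\ell k\le_\ell j\}$, a generalized permutahedron in $\mathbb R I$. Let $Y_n$ be the set of rooted binary trees (each vertex having a possibly empty left and right subtree) with $n$ internal vertices. Number the leaves of $T\in Y_n$ by $0,1,\dots,n$ from left to right, and label by $\ell_i$ the internal vertex between the leaves $i-1$ and $i$ (the binary search labelling). Let $v_\ell(T)=\sum_i l_ir_i\,e_{\ell_i}$, where $l_i$ and $r_i$ are the numbers of leaves that descend from the vertex $\ell_i$ on its left and right side. Let $p_\ell(T)$ be the poset on $I$ whose Hasse diagram is the tree of labelled internal vertices, with left and right forgotten and with the root as minimum, and let $\operatorname{RBT}_\ell=\{p_\ell(T):T\in Y_n\}$. Theorem. The map $T\mapsto v_\ell(T)$ is a bijection from $Y_n$ to the set of vertices of $a_\ell$. For every $T\in Y_n$, $$\operatorname{cone}_{v_\ell(T)}(a_\ell)=\operatorname{cone}(p_\ell(T)),\qquad\text{i.e.}\qquad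 \operatorname{poset}_{v_\ell(T)}(a_\ell)=p_\ell(T).$$ Consequently the Brion map on the Hopf monoid of associahedra is given by $$B(a_\ell)=\sum_{p\in\operatorname{RBT}_\ell}p .$$ -/

import Mathlib

open scoped Pointwise

namespace BrionMap

noncomputable section

/-! ### Polytopes in `ℝI`, normal fans, vertex cones -/

set_option linter.unusedSectionVars false

section Polytopes

variable {I : Type*} [Fintype I]

/-- A polytope in `ℝI`: the convex hull of finitely many points. -/
def IsPolytope (P : Set (I → ℝ)) : Prop :=
  ∃ s : Set (I → ℝ), s.Finite ∧ P = convexHull ℝ s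

/-- The normal cone of a face `F` of `P`: all linear functionals on `ℝI` that attain their
maximum over `P` at every point of `F`. -/
def normalCone (P F : Set (I → ℝ)) : Set (StrongDual ℝ (I → ℝ)) :=
  {y | ∀ x ∈ F, ∀ z ∈ P, y z ≤ y x}

/-- The normal fan: the normal cones of all (nonempty) faces of `P`. -/
def normalFan (P : Set (I → ℝ)) : Set (Set (StrongDual ℝ (I → ℝ))) :=
  {N | ∃ F : Set (I → ℝ), F.Nonempty ∧ IsExposed ℝ P F ∧ N = normalCone P F}

/-- The vertices of a polytope: the points `v` such that `{v}` is a face. -/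
abbrev vertices (P : Set (I → ℝ)) : Set (I → ℝ) := P.exposedPoints ℝ

/-- The directions, pointing away from `v`, of the edges of `P` that have `v` as an endpoint. -/
def edgeDirections (P : Set (I → ℝ)) (v : I → ℝ) : Set (I → ℝ) :=
  {d | ∃ w, w ≠ v ∧ IsExposed ℝ P (segment ℝ v w) ∧ d = w - v}

/-- The vertex cone (tangent cone at a vertex): the cone generated by the directions of the edges
with endpoint `v`, oriented to point away from `v`. -/
def vertexCone (P : Set (I → ℝ)) (v : I → ℝ) : PointedCone ℝ (I → ℝ) :=
  PointedCone.hull ℝ (edgeDirections P v)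

/-- The cone of a poset `p` on `I`, generated by all `e_i - e_j` with `i ≥ j` in `p`. -/
def posetCone [DecidableEq I] (p : PartialOrder I) : PointedCone ℝ (I → ℝ) :=
  PointedCone.hull ℝ {d | ∃ i j : I, p.le j i ∧ d = Pi.single i 1 - Pi.single j 1}

theorem IsPolytope.finite_vertices {P : Set (I → ℝ)} (hP : IsPolytope P) :
    (vertices P).Finite := by
  obtain ⟨s, hs, rfl⟩ := hP
  exact hs.subset (exposedPoints_subset_extremePoints.trans extremePoints_convexHull_subset)

/-- The functional exposing a vertex is nonpositive on the vertex cone and vanishes there only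
at `0`. -/
theorem vertexCone_pointed {P : Set (I → ℝ)} {v : I → ℝ} (hv : v ∈ vertices P) :
    ∃ y : StrongDual ℝ (I → ℝ), ∀ c ∈ vertexCone P v, c = 0 ∨ y c < 0 := by
  obtain ⟨hvP, y, hy⟩ := hv
  refine ⟨y, fun c hc => ?_⟩
  induction hc using Submodule.span_induction with
  | mem d hd =>
    obtain ⟨w, hwv, hF, rfl⟩ := hd
    have hw : w ∈ P := hF.subset (right_mem_segment ℝ v w)
    have h := hy w hw
    right
    rw [map_sub]
    rcases lt_or_ge (y w) (y v) with h1 | h1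
    · linarith
    · exact absurd (h.2 h1) hwv
  | zero => exact Or.inl rfl
  | add a b _ _ ha hb =>
    rcases ha with rfl | ha <;> rcases hb with rfl | hb
    · simp
    · right; simpa using hb
    · right; simpa using ha
    · right; rw [map_add]; linarith
  | smul r a _ ha =>
    rcases ha with rfl | ha
    · simp
    · rcases eq_or_ne r 0 with rfl | hr
      · simp
      · right
        have h1 : r • a = (r : ℝ) • a := rfl
        have h2 : (0 : ℝ) < r := lt_of_le_of_ne r.2 (fun h => hr (Subtype.ext h.symm))
        rw [h1, map_smul, smul_eq_mul]
        exact mul_neg_of_pos_of_neg h2 ha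

/-- `poset_v(P)`, the poset on `I` corresponding to the vertex cone of `P` at the vertex `v`:
`i ≥ j` iff `e_i - e_j` belongs to the vertex cone. -/
def vertexPoset [DecidableEq I] (P : Set (I → ℝ)) (v : I → ℝ) (hv : v ∈ vertices P) :
    PartialOrder I where
  le j i := (Pi.single i 1 - Pi.single j 1 : I → ℝ) ∈ vertexCone P v
  le_refl i := by
    rw [sub_self]
    exact Submodule.zero_mem _
  le_trans a b c hab hbc := by
    have h := Submodule.add_mem _ hbc hab
    rwa [sub_add_sub_cancel] at h
  le_antisymm a b hab hba := by
    obtain ⟨y, hy⟩ := vertexCone_pointed hv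
    rcases hy _ hab with h | h
    · by_contra hne
      have := congrFun (sub_eq_zero.mp h) a
      simp [hne] at this
    · rcases hy _ hba with h' | h'
      · by_contra hne
        have := congrFun (sub_eq_zero.mp h') a
        simp [hne] at this
      · rw [map_sub] at h h'
        linarith

theorem mem_posetCone_iff [DecidableEq I] (p : PartialOrder I) (i j : I) :
    (Pi.single i 1 - Pi.single j 1 : I → ℝ) ∈ posetCone p ↔ p.le j i := by
  classical
  refine ⟨fun h => ?_, fun h => PointedCone.subset_hull ⟨i, j, h, rfl⟩⟩
  have key : ∀ c ∈ posetCone p, 0 ≤ ∑ k, if p.le j k then c k else 0 := by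
    intro c hc
    induction hc using Submodule.span_induction with
    | mem d hd =>
      obtain ⟨a, b, hba, rfl⟩ := hd
      have e : ∀ k, (if p.le j k then (Pi.single a 1 - Pi.single b 1 : I → ℝ) k else 0) =
          (if k = a then (if p.le j k then 1 else 0) else 0)
            - (if k = b then (if p.le j k then 1 else 0) else 0) := by
        intro k
        by_cases h1 : p.le j k <;> simp [h1, Pi.single_apply]
      rw [Finset.sum_congr rfl fun k _ => e k, Finset.sum_sub_distrib, Finset.sum_ite_eq',
        Finset.sum_ite_eq', if_pos (Finset.mem_univ _), if_pos (Finset.mem_univ _)]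
      by_cases h1 : p.le j b
      · have h2 : p.le j a := p.le_trans _ _ _ h1 hba
        simp [h1, h2]
      · by_cases h2 : p.le j a <;> simp [h1, h2]
    | zero => simp
    | add a b _ _ ha hb =>
      refine (add_nonneg ha hb).trans_eq ?_
      rw [← Finset.sum_add_distrib]
      refine Finset.sum_congr rfl fun k _ => ?_
      split_ifs <;> simp
    | smul r a _ ha =>
      refine (mul_nonneg r.2 ha).trans_eq ?_
      rw [Finset.mul_sum]
      refine Finset.sum_congr rfl fun k _ => ?_
      split_ifs
      · rfl
      · simp
  have h1 := key _ h
  by_contra hn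
  have e : ∀ k, (if p.le j k then (Pi.single i 1 - Pi.single j 1 : I → ℝ) k else 0) =
      (if k = j then -1 else 0) := by
    intro k
    rcases eq_or_ne k j with rfl | hk
    · have hki : k ≠ i := fun h => hn (h ▸ p.le_refl k)
      simp [hki]
    · rcases eq_or_ne k i with rfl | hki
      · simp [hn, hk]
      · simp [hk, hki]
  rw [Finset.sum_congr rfl fun k _ => e k, Finset.sum_ite_eq', if_pos (Finset.mem_univ _)] at h1
  linarith

/-- If the vertex cone is the cone of a poset `p`, then `poset_v(P) = p`. -/
theorem vertexPoset_eq_of_cone [DecidableEq I] {P : Set (I → ℝ)} {v : I → ℝ}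
    (hv : v ∈ vertices P) {p : PartialOrder I} (h : vertexCone P v = posetCone p) :
    vertexPoset P v hv = p := by
  refine PartialOrder.ext fun a b => ?_
  rw [← mem_posetCone_iff p b a, ← h]
  rfl

end Polytopes

/-! ### Vertex cones depend only on the normal fan -/

section NormalEquivalence

variable {I : Type*} [Fintype I]

theorem exists_perturb {P : Set (I → ℝ)} (hP : IsPolytope P) (l z : StrongDual ℝ (I → ℝ))
    {x₀ : I → ℝ} (hx₀ : ∀ u ∈ P, l u ≤ l x₀)
    (hz : ∀ u ∈ P, l u = l x₀ → z u = z x₀) :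
    ∃ ε : ℝ, 0 < ε ∧ ∀ u ∈ P, (l + ε • z) u ≤ (l + ε • z) x₀ := by
  obtain ⟨s, hs, rfl⟩ := hP
  have key : ∀ᶠ ε : ℝ in nhdsWithin 0 (Set.Ioi 0), ∀ u ∈ s, l u + ε * z u ≤ l x₀ + ε * z x₀ := by
    rw [Filter.eventually_all_finite hs]
    intro u hu
    have hu' : u ∈ convexHull ℝ s := subset_convexHull ℝ s hu
    rcases (hx₀ u hu').lt_or_eq with h | h
    · have h1 : Continuous fun ε : ℝ => l u + ε * z u := by fun_prop
      have h2 : Continuous fun ε : ℝ => l x₀ + ε * z x₀ := by fun_prop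
      have h3 : ∀ᶠ ε : ℝ in nhds 0, l u + ε * z u < l x₀ + ε * z x₀ :=
        h1.continuousAt.eventually_lt h2.continuousAt (by simpa using h)
      exact (h3.filter_mono nhdsWithin_le_nhds).mono fun ε hε => hε.le
    · exact Filter.Eventually.of_forall fun ε => by rw [h, hz u hu' h]
  obtain ⟨ε, hε, hpos⟩ := (key.and self_mem_nhdsWithin).exists
  refine ⟨ε, hpos, fun u hu => ?_⟩
  have hc : Convex ℝ {u : I → ℝ | (l + ε • z) u ≤ (l + ε • z) x₀} :=
    convex_halfSpace_le (l + ε • z).isBoundedLinearMap.toIsLinearMap _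
  exact convexHull_min (fun u hu => by simpa using hε u hu) hc hu

theorem eq_of_dual {x x' : I → ℝ} (h : ∀ z : StrongDual ℝ (I → ℝ), z x = z x') : x = x' := by
  ext i
  exact h (ContinuousLinearMap.proj i)

theorem exists_strict {P : Set (I → ℝ)} {v : I → ℝ} (hv : v ∈ vertices P) :
    ∃ l ∈ normalCone P {v}, ∀ u ∈ P, l v ≤ l u → u = v := by
  obtain ⟨hvP, l, hl⟩ := hv
  refine ⟨l, ?_, fun u hu h => (hl u hu).2 h⟩
  rintro x rfl z hz
  exact (hl z hz).1

/-- Along normally equivalent polytopes, vertices correspond. -/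
theorem exists_vertex {P Q : Set (I → ℝ)} (hP : IsPolytope P) (h : normalFan P = normalFan Q)
    {v : I → ℝ} (hv : v ∈ vertices P) :
    ∃ v' ∈ vertices Q, normalCone P {v} = normalCone Q {v'} := by
  have hmem : normalCone P {v} ∈ normalFan P :=
    ⟨{v}, Set.singleton_nonempty v, mem_exposedPoints_iff_exposed_singleton.mp hv, rfl⟩
  rw [h] at hmem
  obtain ⟨F, hF, hFe, hN⟩ := hmem
  obtain ⟨l, hl, hls⟩ := exists_strict hv
  have hsub : ∀ x ∈ F, ∀ x' ∈ F, x = x' := by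
    intro x hx x' hx'
    refine eq_of_dual fun z => ?_
    obtain ⟨ε, hε, hpert⟩ := exists_perturb hP l z (x₀ := v) (hl v rfl)
      (fun u hu hu' => by rw [hls u hu hu'.ge])
    have hm : l + ε • z ∈ normalCone P {v} := by
      rintro _ rfl u hu
      exact hpert u hu
    rw [hN] at hm hl
    have h1 := hm x hx x' (hFe.subset hx')
    have h2 := hm x' hx' x (hFe.subset hx)
    have h3 := hl x hx x' (hFe.subset hx')
    have h4 := hl x' hx' x (hFe.subset hx)
    simp only [add_apply, smul_apply, smul_eq_mul] at h1 h2
    have h5 : ε * z x = ε * z x' := by linarith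
    exact mul_left_cancel₀ hε.ne' h5
  obtain ⟨v', hv'⟩ := hF
  have hFs : F = {v'} := Set.eq_singleton_iff_unique_mem.mpr ⟨hv', fun x hx => hsub x hx v' hv'⟩
  subst hFs
  exact ⟨v', mem_exposedPoints_iff_exposed_singleton.mpr hFe, hN⟩

theorem vertex_unique {P : Set (I → ℝ)} {v w : I → ℝ} (hv : v ∈ vertices P)
    (hw : w ∈ vertices P) (h : normalCone P {v} = normalCone P {w}) : v = w := by
  obtain ⟨l, hl, hls⟩ := exists_strict hv
  rw [h] at hl
  exact (hls w hw.1 (hl w rfl v hv.1)).symm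

theorem vertexCone_le {P Q : Set (I → ℝ)} (hP : IsPolytope P) (hQ : IsPolytope Q)
    (h : normalFan P = normalFan Q) {v v' : I → ℝ} (hv : v ∈ vertices P) (hv' : v' ∈ vertices Q)
    (hvv : normalCone P {v} = normalCone Q {v'}) : vertexCone P v ≤ vertexCone Q v' := by
  refine Submodule.span_le.mpr ?_
  rintro d ⟨w, hwv, hF, rfl⟩
  obtain ⟨y, hy⟩ := hF ⟨v, left_mem_segment ℝ v w⟩
  have hvF : v ∈ segment ℝ v w := left_mem_segment ℝ v w
  have hwF : w ∈ segment ℝ v w := right_mem_segment ℝ v w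
  have hymax : ∀ x ∈ segment ℝ v w, x ∈ P ∧ ∀ u ∈ P, y u ≤ y x := by
    intro x hx
    rw [hy] at hx
    exact hx
  have hyv : y ∈ normalCone P {v} := by
    rintro _ rfl
    exact (hymax _ hvF).2
  have hyv' : y ∈ normalCone Q {v'} := hvv ▸ hyv
  -- the `y`-maximal face of `Q`
  set G : Set (I → ℝ) := y.toExposed Q with hG
  have hv'G : v' ∈ G := ⟨hv'.1, hyv' v' rfl⟩
  have hGe : IsExposed ℝ Q G := ContinuousLinearMap.toExposed.isExposed
  have hsubN : normalCone P (segment ℝ v w) ⊆ normalCone Q G := by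
    have hm : normalCone Q G ∈ normalFan Q := ⟨G, ⟨v', hv'G⟩, hGe, rfl⟩
    rw [← h] at hm
    obtain ⟨F, hFn, hFe, hN⟩ := hm
    have hyG : y ∈ normalCone Q G := fun x hx => hx.2
    rw [hN] at hyG ⊢
    intro t ht x hx
    refine ht x ?_
    rw [hy]
    exact ⟨hFe.subset hx, hyG x hx⟩
  obtain ⟨z₀, hz₀⟩ : ∃ z₀ : StrongDual ℝ (I → ℝ), z₀ (w - v) = 1 := by
    have hne : w - v ≠ 0 := sub_ne_zero.mpr hwv
    obtain ⟨i, hi⟩ := Function.ne_iff.mp hne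
    refine ⟨((w - v) i)⁻¹ • ContinuousLinearMap.proj i, ?_⟩
    simpa using inv_mul_cancel₀ hi
  -- every point of `G` lies on the line through `v'` with direction `w - v`
  have hline : ∀ x ∈ G, x = v' + z₀ (x - v') • (w - v) := by
    intro x hx
    refine eq_of_dual fun z => ?_
    set z' := z - z (w - v) • z₀ with hz'
    have hz'0 : z' (w - v) = 0 := by simp [hz', hz₀]
    have hconst : ∀ u ∈ segment ℝ v w, z' u = z' v := by
      intro u hu
      rw [segment_eq_image'] at hu
      obtain ⟨θ, -, rfl⟩ := hu
      simp only [map_add, map_smul]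
      rw [hz'0]
      simp
    obtain ⟨ε, hε, hpert⟩ := exists_perturb hP y z' (x₀ := v) (hyv v rfl) (fun u hu hu' => by
      refine hconst u ?_
      rw [hy]
      exact ⟨hu, fun a ha => hu' ▸ hyv v rfl a ha⟩)
    have hm : y + ε • z' ∈ normalCone P (segment ℝ v w) := by
      intro u hu a ha
      refine (hpert a ha).trans_eq ?_
      have e1 : y u = y v := le_antisymm ((hymax v hvF).2 u (hymax u hu).1)
        ((hymax u hu).2 v (hymax v hvF).1)
      simp only [add_apply, smul_apply]
      rw [e1, hconst u hu]
    have hmG := hsubN hm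
    have h1 := hmG x hx v' hv'.1
    have h2 := hmG v' hv'G x hx.1
    have h3 := hx.2 v' hv'.1
    have h4 := hv'G.2 x hx.1
    simp only [add_apply, smul_apply, smul_eq_mul] at h1 h2
    have h5 : ε * z' x = ε * z' v' := by linarith
    have h6 : z' x = z' v' := mul_left_cancel₀ hε.ne' h5
    simp only [hz', sub_apply, smul_apply,
      smul_eq_mul] at h6
    simp only [map_add, map_smul, smul_eq_mul, map_sub] at h6 ⊢
    linarith
  -- all of `G` lies on the correct side of `v'`
  obtain ⟨y', hy', hy's⟩ := exists_strict hv
  have hy'neg : y' (w - v) < 0 := by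
    rw [map_sub]
    rcases lt_or_ge (y' w) (y' v) with h1 | h1
    · linarith
    · exact absurd (hy's w (hymax w hwF).1 h1) hwv
  have hy'Q : y' ∈ normalCone Q {v'} := hvv ▸ hy'
  have hside : ∀ x ∈ G, 0 ≤ z₀ (x - v') := by
    intro x hx
    have h1 := hy'Q v' rfl x hx.1
    rw [hline x hx, map_add, map_smul, smul_eq_mul] at h1
    by_contra h2
    push Not at h2
    nlinarith [mul_pos_of_neg_of_neg h2 hy'neg]
  -- `G` is not a point
  have hnontriv : ∃ x ∈ G, x ≠ v' := by
    by_contra hcon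
    push Not at hcon
    obtain ⟨ε, hε, hpert⟩ := exists_perturb hQ y z₀ (x₀ := v') (hyv' v' rfl) (fun u hu hu' => by
      rw [hcon u ⟨hu, fun a ha => hu' ▸ hyv' v' rfl a ha⟩])
    have hm : y + ε • z₀ ∈ normalCone Q {v'} := by
      rintro _ rfl a ha
      exact hpert a ha
    rw [← hvv] at hm
    have h1 := hm v rfl w (hymax w hwF).1
    have h2 := (hymax w hwF).2 v (hymax v hvF).1
    rw [map_sub] at hz₀
    simp only [add_apply, smul_apply, smul_eq_mul] at h1
    nlinarith
  -- the far endpoint of the edge `G`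
  have hQc : IsCompact Q := by
    obtain ⟨s, hs, rfl⟩ := hQ
    exact hs.isCompact_convexHull (𝕜 := ℝ)
  have hQconv : Convex ℝ Q := by
    obtain ⟨s, hs, rfl⟩ := hQ
    exact convex_convexHull ℝ s
  have hGc : IsCompact G := hGe.isCompact hQc
  have hGconv : Convex ℝ G := hGe.convex hQconv
  obtain ⟨w', hw'G, hw'max⟩ := hGc.exists_isMaxOn ⟨v', hv'G⟩ z₀.continuous.continuousOn
  have hmaxle : ∀ x ∈ G, z₀ (x - v') ≤ z₀ (w' - v') := by
    intro x hx
    have h1 : z₀ x ≤ z₀ w' := hw'max hx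
    rw [map_sub, map_sub]
    linarith
  obtain ⟨x₁, hx₁G, hx₁⟩ := hnontriv
  have hpos : 0 < z₀ (w' - v') := by
    refine lt_of_lt_of_le (lt_of_le_of_ne (hside x₁ hx₁G) fun h0 => hx₁ ?_) (hmaxle x₁ hx₁G)
    rw [hline x₁ hx₁G, ← h0]
    simp
  have hw'eq := hline w' hw'G
  set T := z₀ (w' - v') with hT
  have hseg : segment ℝ v' w' = G := by
    refine Set.Subset.antisymm (hGconv.segment_subset hv'G hw'G) fun x hx => ?_
    rw [segment_eq_image']
    refine ⟨z₀ (x - v') / T, ⟨div_nonneg (hside x hx) hpos.le,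
      (div_le_one hpos).mpr (hmaxle x hx)⟩, ?_⟩
    have : w' - v' = T • (w - v) := by
      rw [hw'eq]; simp
    change v' + (z₀ (x - v') / T) • (w' - v') = x
    rw [this, smul_smul, div_mul_cancel₀ _ hpos.ne']
    exact (hline x hx).symm
  have hne : w' ≠ v' := by
    rintro rfl
    rw [hT] at hpos
    simp at hpos
  have hmem : w' - v' ∈ vertexCone Q v' :=
    PointedCone.subset_hull ⟨w', hne, hseg ▸ hGe, rfl⟩
  have hfin : w - v = T⁻¹ • (w' - v') := by
    rw [hw'eq]
    simp [hpos.ne']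
  rw [hfin]
  exact PointedCone.smul_mem _ (inv_nonneg.mpr hpos.le) hmem

theorem vertexCone_congr {P Q : Set (I → ℝ)} (hP : IsPolytope P) (hQ : IsPolytope Q)
    (h : normalFan P = normalFan Q) {v v' : I → ℝ} (hv : v ∈ vertices P) (hv' : v' ∈ vertices Q)
    (hvv : normalCone P {v} = normalCone Q {v'}) : vertexCone P v = vertexCone Q v' :=
  le_antisymm (vertexCone_le hP hQ h hv hv' hvv) (vertexCone_le hQ hP h.symm hv' hv hvv.symm)

end NormalEquivalence

/-! ### Generalized permutahedra up to normal equivalence and the Brion map -/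

section Brion

/-- The standard permutahedron `π_I`: the convex hull of the points `∑ f(i) e_i` for all
bijections `f : I → {1, …, n}`. -/
def permutahedron (I : Type*) [Fintype I] : Set (I → ℝ) :=
  convexHull ℝ {x | ∃ f : I ≃ Fin (Fintype.card I), x = fun i => ((f i : ℕ) : ℝ) + 1}

/-- A generalized permutahedron: a polytope whose normal fan is a coarsening of the braid fan,
the normal fan of the standard permutahedron. -/
def IsGeneralizedPermutahedron {I : Type*} [Fintype I] (P : Set (I → ℝ)) : Prop :=
  IsPolytope P ∧ ∀ C ∈ normalFan (permutahedron I), ∃ D ∈ normalFan P, C ⊆ D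

/-- The set of generalized permutahedra in `ℝI`. -/
abbrev GP (I : Type*) [Fintype I] : Type _ :=
  {P : Set (I → ℝ) // IsGeneralizedPermutahedron P}

/-- Normal equivalence: having the same normal fan. -/
def normalEquivalence (I : Type*) [Fintype I] : Setoid (GP I) :=
  Setoid.ker fun P => normalFan P.1

/-- The set of normal equivalence classes of generalized permutahedra in `ℝI`. -/
abbrev GPClass (I : Type*) [Fintype I] : Type _ := Quotient (normalEquivalence I)

/-- The component at `I` of the Hopf monoid of generalized permutahedra up to normal equivalence:
the vector space with basis the normal equivalence classes. -/
abbrev GPSpace (K : Type*) [Field K] (I : Type*) [Fintype I] : Type _ := GPClass I →₀ K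

/-- The component at `I` of the Hopf monoid of posets: the vector space with basis the partial
orders on `I`. -/
abbrev PosetSpace (K : Type*) [Field K] (I : Type*) : Type _ := PartialOrder I →₀ K

variable (K : Type*) [Field K] {I : Type*} [Fintype I] [DecidableEq I]

instance (P : GP I) : Fintype (vertices P.1) := P.2.1.finite_vertices.fintype

/-- `∑_v poset_v(P)`, the sum over all vertices `v` of the generalized permutahedron `P`. -/
def vertexPosetSum (P : GP I) : PosetSpace K I :=
  ∑ v : vertices P.1, Finsupp.single (vertexPoset P.1 v.1 v.2) 1

theorem vertexPosetSum_congr (P Q : GP I) (h : normalFan P.1 = normalFan Q.1) :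
    vertexPosetSum K P = vertexPosetSum K Q := by
  have hex : ∀ v : vertices P.1, ∃ v' : vertices Q.1,
      normalCone P.1 {v.1} = normalCone Q.1 {v'.1} := fun v =>
    let ⟨v', hv', hN⟩ := exists_vertex P.2.1 h v.2
    ⟨⟨v', hv'⟩, hN⟩
  choose f hf using hex
  have hbij : Function.Bijective f := by
    constructor
    · intro a b hab
      refine Subtype.ext (vertex_unique a.2 b.2 ?_)
      rw [hf a, hf b, hab]
    · intro b
      obtain ⟨a, ha, hN⟩ := exists_vertex Q.2.1 h.symm b.2
      refine ⟨⟨a, ha⟩, Subtype.ext (vertex_unique (f ⟨a, ha⟩).2 b.2 ?_)⟩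
      rw [← hf ⟨a, ha⟩, hN]
  refine Fintype.sum_bijective f hbij _ _ fun v => ?_
  congr 1
  refine PartialOrder.ext fun a b => ?_
  change _ ∈ vertexCone P.1 v.1 ↔ _ ∈ vertexCone Q.1 (f v).1
  rw [vertexCone_congr P.2.1 Q.2.1 h v.2 (f v).2 (hf v)]

/-- The Brion map: the linear map that sends the class of `P` to the sum over all vertices `v`
of `P` of the posets `poset_v(P)`. -/
def brion : GPSpace K I →ₗ[K] PosetSpace K I :=
  Finsupp.linearCombination K
    (Quotient.lift (s := normalEquivalence I) (vertexPosetSum K)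
      fun P Q h => vertexPosetSum_congr K P Q h)

end Brion

/-! ### The Loday associahedron of a linear order -/

section Associahedron

variable (I : Type*) [Fintype I] [LinearOrder I]

/-- The Loday associahedron of the linearly ordered set `I`: the Minkowski sum, over all
`i ≤ j`, of the simplices `conv {e_k : i ≤ k ≤ j}`. -/
def associahedron : Set (I → ℝ) :=
  ∑ q ∈ (Finset.univ : Finset (I × I)) with q.1 ≤ q.2,
    convexHull ℝ ((fun k : I => (Pi.single k 1 : I → ℝ)) '' Set.Icc q.1 q.2)

theorem isPolytope_associahedron : IsPolytope (associahedron I) := by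
  refine ⟨∑ q ∈ (Finset.univ : Finset (I × I)) with q.1 ≤ q.2,
    (fun k : I => (Pi.single k 1 : I → ℝ)) '' Set.Icc q.1 q.2, ?_, ?_⟩
  · refine Finset.sum_induction _ Set.Finite (fun a b => Set.Finite.add) Set.finite_zero
      fun q _ => Set.toFinite _
  · rw [convexHull_sum]
    rfl

variable {I}

theorem isGeneralizedPermutahedron_associahedron :
    IsGeneralizedPermutahedron (associahedron I) := by
  refine ⟨isPolytope_associahedron I, ?_⟩
  rintro C ⟨F, ⟨x₀, hx₀⟩, hFe, rfl⟩
  obtain ⟨l, hl⟩ := hFe ⟨x₀, hx₀⟩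
  -- the face contains a vertex of the permutahedron
  obtain ⟨f, hfF⟩ : ∃ f : I ≃ Fin (Fintype.card I),
      (fun i => ((f i : ℕ) : ℝ) + 1) ∈ F := by
    have hx := hx₀
    rw [hl] at hx
    obtain ⟨p, ⟨f, rfl⟩, hp⟩ := (l.toLinearMap.convexOn convex_univ).exists_ge_of_mem_convexHull
      (Set.subset_univ _) hx.1
    refine ⟨f, ?_⟩
    rw [hl]
    exact ⟨subset_convexHull ℝ _ ⟨f, rfl⟩, fun u hu => (hx.2 u hu).trans hp⟩
  set c : StrongDual ℝ (I → ℝ) → I → ℝ := fun y i => y (Pi.single i 1) with hc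
  have happ : ∀ (y : StrongDual ℝ (I → ℝ)) (x : I → ℝ), y x = ∑ i, x i * c y i := by
    intro y x
    conv_lhs => rw [pi_eq_sum_univ' x]
    rw [map_sum]
    refine Finset.sum_congr rfl fun i _ => ?_
    rw [map_smul, smul_eq_mul]
  have hchamber : ∀ y ∈ normalCone (permutahedron I) F, ∀ i j, f i ≤ f j → c y i ≤ c y j := by
    intro y hy i j hij
    rcases eq_or_ne i j with rfl | hne
    · exact le_rfl
    have hlt : (f i : ℕ) < f j := lt_of_le_of_ne hij fun h => hne (f.injective (Fin.ext h))
    have h1 := hy _ hfF (fun k => (((Equiv.swap i j).trans f k : ℕ) : ℝ) + 1)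
      (subset_convexHull ℝ _ ⟨(Equiv.swap i j).trans f, rfl⟩)
    have h2 : (fun k => (((Equiv.swap i j).trans f k : ℕ) : ℝ) + 1)
        = (fun k => ((f k : ℕ) : ℝ) + 1)
          + (((f j : ℕ) : ℝ) - (f i : ℕ)) • (Pi.single i 1 - Pi.single j 1 : I → ℝ) := by
      funext k
      rcases eq_or_ne k i with rfl | hki
      · simp [hne]; ring
      · rcases eq_or_ne k j with rfl | hkj
        · simp [hne.symm]; ring
        · simp [hki, hkj, Equiv.swap_apply_of_ne_of_ne hki hkj]
    rw [h2, map_add, map_smul, map_sub, smul_eq_mul] at h1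
    have h3 : (0 : ℝ) < ((f j : ℕ) : ℝ) - (f i : ℕ) := by
      rw [sub_pos]; exact_mod_cast hlt
    change y (Pi.single i 1) ≤ y (Pi.single j 1)
    nlinarith
  -- the point of the associahedron selected by the permutation `f`
  have harg : ∀ q : I × I, ∃ m : I, q.1 ≤ q.2 →
      m ∈ Set.Icc q.1 q.2 ∧ ∀ k ∈ Set.Icc q.1 q.2, f k ≤ f m := by
    intro q
    by_cases hq : q.1 ≤ q.2
    · obtain ⟨m, hm, hmax⟩ := Set.exists_max_image (Set.Icc q.1 q.2) f (Set.toFinite _)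
        ⟨q.1, Set.left_mem_Icc.mpr hq⟩
      exact ⟨m, fun _ => ⟨hm, hmax⟩⟩
    · exact ⟨q.1, fun h => absurd h hq⟩
  choose m hm using harg
  set vs : I → ℝ := ∑ q ∈ (Finset.univ : Finset (I × I)) with q.1 ≤ q.2, Pi.single (m q) 1 with hvs
  have hvsmem : vs ∈ associahedron I := by
    refine Set.finsetSum_mem_finsetSum _ _ _ fun q hq => ?_
    exact subset_convexHull ℝ _ ⟨m q, (hm q (Finset.mem_filter.mp hq).2).1, rfl⟩
  have hmaxvs : ∀ y : StrongDual ℝ (I → ℝ), (∀ i j, f i ≤ f j → c y i ≤ c y j) →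
      ∀ z ∈ associahedron I, y z ≤ y vs := by
    intro y hy z hz
    obtain ⟨g, hg, rfl⟩ := (Set.mem_finsetSum _ _ _).mp hz
    rw [hvs, map_sum, map_sum]
    refine Finset.sum_le_sum fun q hq => ?_
    have hq' := hm q (Finset.mem_filter.mp hq).2
    obtain ⟨p, ⟨k, hk, rfl⟩, hp⟩ := (y.toLinearMap.convexOn convex_univ).exists_ge_of_mem_convexHull
      (Set.subset_univ _) (hg hq)
    exact le_trans hp (hy k (m q) (hq'.2 k hk))
  -- a functional in the interior of the chamber
  set p : StrongDual ℝ (I → ℝ) := ∑ i, ((f i : ℕ) : ℝ) • ContinuousLinearMap.proj i with hp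
  have hcp : ∀ i, c p i = (f i : ℕ) := by
    intro i
    simp [hc, hp, Pi.single_apply]
  have hne : (p.toExposed (associahedron I)).Nonempty :=
    ⟨vs, hvsmem, hmaxvs p fun i j hij => by rw [hcp, hcp]; exact_mod_cast hij⟩
  refine ⟨normalCone (associahedron I) (p.toExposed (associahedron I)),
    ⟨_, hne, ContinuousLinearMap.toExposed.isExposed, rfl⟩, ?_⟩
  intro y hy x hx z hz
  have hych := hchamber y hy
  refine (hmaxvs y hych z hz).trans ?_
  set M : ℝ := 2 * ∑ i, |c y i| with hM
  have hbd : ∀ i, |c y i| ≤ ∑ i, |c y i| := fun i =>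
    Finset.single_le_sum (f := fun i => |c y i|) (fun j _ => abs_nonneg _) (Finset.mem_univ i)
  have h1 := hmaxvs (M • p - y) (fun i j hij => by
    have e : ∀ k, c (M • p - y) k = M * c p k - c y k := fun k => by simp [hc]
    rw [e, e, hcp, hcp]
    rcases eq_or_ne i j with rfl | hne
    · exact le_rfl
    have hlt : (f i : ℕ) < f j := lt_of_le_of_ne hij fun h => hne (f.injective (Fin.ext h))
    have h3 : ((f i : ℕ) : ℝ) + 1 ≤ (f j : ℕ) := by exact_mod_cast hlt
    have h4 := hbd i
    have h5 := hbd j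
    have h6 := neg_abs_le (c y i)
    have h7 := le_abs_self (c y j)
    have h8 : 0 ≤ M := by rw [hM]; exact mul_nonneg zero_le_two ((abs_nonneg _).trans h4)
    nlinarith [mul_nonneg h8 (sub_nonneg.mpr h3)]) x hx.1
  have h2 := hx.2 vs hvsmem
  have h3 := hmaxvs p (fun i j hij => by rw [hcp, hcp]; exact_mod_cast hij) x hx.1
  simp only [sub_apply, smul_apply, smul_eq_mul] at h1
  rw [le_antisymm h3 h2] at h1
  linarith

variable (K : Type*) [Field K] (I)

/-- The basis element `a_ℓ` of the space of generalized permutahedra up to normal equivalence: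
the class of the Loday associahedron. -/
def associahedronClass : GPSpace K I :=
  Finsupp.single
    (Quotient.mk (normalEquivalence I)
      ⟨associahedron I, isGeneralizedPermutahedron_associahedron⟩) 1

end Associahedron

/-! ### Rooted binary trees, the binary search labelling, and RBT posets -/

section Trees

/-- The labelling of the internal vertices of a rooted binary tree by consecutive natural numbers:
if the leaves are numbered `k, k + 1, …` from left to right, the internal vertex between the
leaves `m` and `m + 1` gets the label `m`. -/
def labelFrom : ℕ → BinaryTree Unit → BinaryTree ℕ
  | _, .nil => .nil
  | k, .node _ a b =>
    .node (k + a.numNodes) (labelFrom k a) (labelFrom (k + a.numNodes + 1) b)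

/-- The binary search labelling, by `0, …, n - 1`; the label `m` stands for the `(m + 1)`-st
smallest element of the linear order. -/
def searchLabelling (T : BinaryTree Unit) : BinaryTree ℕ := labelFrom 0 T

/-- In a tree with distinct labels, the number of leaves on the left side of the internal
vertex `x`. -/
def leftLeaves : BinaryTree ℕ → ℕ → ℕ
  | .nil, _ => 0
  | .node c a b, x => if x = c then a.numLeaves else leftLeaves a x + leftLeaves b x

/-- In a tree with distinct labels, the number of leaves on the right side of the internal
vertex `x`. -/
def rightLeaves : BinaryTree ℕ → ℕ → ℕ
  | .nil, _ => 0
  | .node c a b, x => if x = c then b.numLeaves else rightLeaves a x + rightLeaves b x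

/-- The label of the root, if the tree is not empty. -/
def rootLabel : BinaryTree ℕ → Option ℕ
  | .nil => none
  | .node c _ _ => some c

/-- `IsChild t x y`: in the pruned tree `t` some vertex labelled `x` is a (left or right) child of
a vertex labelled `y`. -/
def IsChild : BinaryTree ℕ → ℕ → ℕ → Prop
  | .nil, _, _ => False
  | .node c a b, x, y =>
    (y = c ∧ (rootLabel a = some x ∨ rootLabel b = some x)) ∨ IsChild a x y ∨ IsChild b x y

theorem numLeaves_labelFrom (k : ℕ) (T : BinaryTree Unit) :
    (labelFrom k T).numLeaves = T.numLeaves := by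
  induction T generalizing k with
  | nil => rfl
  | node c a b iha ihb => simp [labelFrom, iha, ihb]

theorem leaves_eq_zero (k : ℕ) (T : BinaryTree Unit) (x : ℕ)
    (hx : x < k ∨ k + T.numNodes ≤ x) :
    leftLeaves (labelFrom k T) x = 0 ∧ rightLeaves (labelFrom k T) x = 0 := by
  induction T generalizing k with
  | nil => exact ⟨rfl, rfl⟩
  | node c a b iha ihb =>
    simp only [BinaryTree.numNodes] at hx
    have h1 := iha k (by omega)
    have h2 := ihb (k + a.numNodes + 1) (by omega)
    have h3 : x ≠ k + a.numNodes := by omega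
    simp [labelFrom, leftLeaves, rightLeaves, h1, h2, h3]

theorem rootLabel_labelFrom (k : ℕ) (T : BinaryTree Unit) (x : ℕ)
    (hx : rootLabel (labelFrom k T) = some x) :
    k ≤ x ∧ x < k + T.numNodes ∧
      leftLeaves (labelFrom k T) x + rightLeaves (labelFrom k T) x = T.numLeaves := by
  cases T with
  | nil => simp [labelFrom, rootLabel] at hx
  | node c a b =>
    simp only [labelFrom, rootLabel, Option.some.injEq] at hx
    subst hx
    simp only [BinaryTree.numNodes, BinaryTree.numLeaves, labelFrom, leftLeaves, rightLeaves,
      numLeaves_labelFrom, if_true, and_true]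
    omega

theorem isChild_labelFrom (k : ℕ) (T : BinaryTree Unit) (x y : ℕ)
    (h : IsChild (labelFrom k T) x y) :
    (k ≤ x ∧ x < k + T.numNodes) ∧ (k ≤ y ∧ y < k + T.numNodes) ∧
      leftLeaves (labelFrom k T) x + rightLeaves (labelFrom k T) x <
        leftLeaves (labelFrom k T) y + rightLeaves (labelFrom k T) y := by
  induction T generalizing k with
  | nil => exact h.elim
  | node c a b iha ihb =>
    have pa := a.numLeaves_pos
    have pb := b.numLeaves_pos
    simp only [labelFrom, leftLeaves, rightLeaves, BinaryTree.numNodes, numLeaves_labelFrom]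
    rcases h with ⟨rfl, h | h⟩ | h | h
    · obtain ⟨h1, h2, h3⟩ := rootLabel_labelFrom _ _ _ h
      have h4 := leaves_eq_zero (k + a.numNodes + 1) b x (by omega)
      have h5 : x ≠ k + a.numNodes := by omega
      simp only [h5, h4, if_false, if_true]
      omega
    · obtain ⟨h1, h2, h3⟩ := rootLabel_labelFrom _ _ _ h
      have h4 := leaves_eq_zero k a x (by omega)
      have h5 : x ≠ k + a.numNodes := by omega
      simp only [h5, h4, if_false, if_true]
      omega
    · obtain ⟨h1, h2, h3⟩ := iha k h
      have h4 := leaves_eq_zero (k + a.numNodes + 1) b x (by omega)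
      have h4' := leaves_eq_zero (k + a.numNodes + 1) b y (by omega)
      have h5 : x ≠ k + a.numNodes := by omega
      have h5' : y ≠ k + a.numNodes := by omega
      simp only [h5, h5', h4, h4', if_false]
      omega
    · obtain ⟨h1, h2, h3⟩ := ihb (k + a.numNodes + 1) h
      have h4 := leaves_eq_zero k a x (by omega)
      have h4' := leaves_eq_zero k a y (by omega)
      have h5 : x ≠ k + a.numNodes := by omega
      have h5' : y ≠ k + a.numNodes := by omega
      simp only [h5, h5', h4, h4', if_false]
      omega

theorem descendant_antisymm (T : BinaryTree Unit) {x y : ℕ}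
    (h : Relation.ReflTransGen (IsChild (searchLabelling T)) x y)
    (h' : Relation.ReflTransGen (IsChild (searchLabelling T)) y x) : x = y := by
  have key : ∀ {x y : ℕ}, Relation.ReflTransGen (IsChild (searchLabelling T)) x y → x = y ∨
      leftLeaves (searchLabelling T) x + rightLeaves (searchLabelling T) x <
        leftLeaves (searchLabelling T) y + rightLeaves (searchLabelling T) y := by
    intro x y h
    induction h with
    | refl => exact Or.inl rfl
    | tail _ hbc ih =>
      have h1 := (isChild_labelFrom 0 T _ _ hbc).2.2
      right
      rcases ih with rfl | ih
      · exact h1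
      · exact ih.trans h1
  rcases key h with rfl | h1
  · rfl
  · rcases key h' with rfl | h2
    · rfl
    · omega

variable {I : Type*} [Fintype I] [LinearOrder I]

/-- The number of elements below `i`. -/
def rank (i : I) : ℕ := (Finset.univ.filter fun j : I => j < i).card

theorem rank_injective : Function.Injective (rank : I → ℕ) := by
  have hmono : StrictMono (rank : I → ℕ) := by
    intro i j hij
    refine Finset.card_lt_card (Finset.ssubset_iff_of_subset ?_ |>.mpr ⟨i, by simpa, by simp⟩)
    intro k hk
    simp only [Finset.mem_filter, Finset.mem_univ, true_and] at hk ⊢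
    exact hk.trans hij
  exact hmono.injective

variable (I)

/-- `Y_n` for `n = |I|`: the rooted binary trees with `n` internal vertices. -/
abbrev treesOn : Finset (BinaryTree Unit) := BinaryTree.treesOfNumNodesEq (Fintype.card I)

variable {I}

/-- The point `v_ℓ(T)`, whose `i`-th coordinate is the number of leaves on the left side of the
vertex labelled `i` times the number of leaves on its right side. -/
def lodayVertex (T : BinaryTree Unit) : I → ℝ := fun i =>
  (leftLeaves (searchLabelling T) (rank i) : ℝ) * rightLeaves (searchLabelling T) (rank i)

/-- The poset `p_ℓ(T)`: the root is the minimum, and `j ≤ i` iff the vertex labelled `i` is reached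
from the vertex labelled `j` by passing to a (left or right) child repeatedly. -/
def treePoset (T : BinaryTree Unit) : PartialOrder I where
  le j i := Relation.ReflTransGen (IsChild (searchLabelling T)) (rank i) (rank j)
  lt j i := Relation.ReflTransGen (IsChild (searchLabelling T)) (rank i) (rank j) ∧
    ¬ Relation.ReflTransGen (IsChild (searchLabelling T)) (rank j) (rank i)
  lt_iff_le_not_ge _ _ := Iff.rfl
  le_refl _ := Relation.ReflTransGen.refl
  le_trans _ _ _ hab hbc := Relation.ReflTransGen.trans hbc hab
  le_antisymm _ _ hab hba := rank_injective (descendant_antisymm T hba hab)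

variable (I)

open Classical in
/-- `RBT_ℓ`: the set of all rooted binary tree posets for the linear order on `I`. -/
def RBT : Finset (PartialOrder I) := (treesOn I).image treePoset

end Trees

end

end BrionMap

/-!
Let `T` be a tree with `n` internal vertices, labelled by binary search. The descendants of the
internal vertex `z`, including `z`, carry the labels strictly between `z - l_z` and `z + r_z`
(`reflTransGen_isChild_iff`). Hence every interval `[i, j]` of labels contains a lowest common
ancestor of all its elements, the minimum of `[i, j]` for the tree poset, and exactly `l_z r_z`
intervals have the lowest common ancestor `z`. So `v_ℓ(T)` is the sum of the vertices `e_m` of the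
simplices `conv {e_k : i ≤ k ≤ j}`, where `m` is the lowest common ancestor of `i` and `j`
(`lodayVertex_eq_sum`).

Since all `k ∈ [i, j]` descend from `m`, all differences `e_k - e_m` belong to the cone of the tree
poset, and so the associahedron is contained in `v_ℓ(T) + cone(p_ℓ(T))`
(`sub_lodayVertex_mem_posetCone`). This has the following consequences.

* A functional that decreases strictly from parents to children exposes `v_ℓ(T)`, which is therefore
  a vertex.
* A functional exposing a vertex decreases weakly from parents to children for some tree, which is
  built from its maximum (`exists_decreasing_tree`); the vertex is the point of this tree.
* The directions of the edges at `v_ℓ(T)` lie in `cone(p_ℓ(T))`.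

Conversely, the cone of the tree poset is generated by the vectors `e_x - e_z` with `x` a child of
`z`. A functional that takes the same value at `x` and `z` and is strict on all other relations of
the poset exposes a face contained in a ray of direction `e_x - e_z`. This face is not a point,
because `e_z` may be replaced by `e_x` in the summand of the interval between `x` and `z`. So it is
an edge (`single_sub_single_mem_vertexCone_of_isChild`), and the two cones agree
(`vertexCone_lodayVertex`).

Finally a tree is determined by its numbers `l_z` and `r_z`, hence by its poset (`treePoset_injOn`).
With the equality of the cones this gives the injectivity of `v_ℓ`, and it turns the sum over the
vertices in the Brion map into the sum over the tree posets.
-/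

namespace BrionMap

/-! ### Descendants in the binary search labelling -/

section Descendants

theorem leaves_labelFrom_left (k : ℕ) (u : Unit) (a b : BinaryTree Unit) {x : ℕ}
    (hx : x < k + a.numNodes) :
    leftLeaves (labelFrom k (.node u a b)) x = leftLeaves (labelFrom k a) x ∧
      rightLeaves (labelFrom k (.node u a b)) x = rightLeaves (labelFrom k a) x := by
  have h := leaves_eq_zero (k + a.numNodes + 1) b x (by omega)
  have h5 : x ≠ k + a.numNodes := by omega
  simp [labelFrom, leftLeaves, rightLeaves, h, h5]

theorem leaves_labelFrom_right (k : ℕ) (u : Unit) (a b : BinaryTree Unit) {x : ℕ}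
    (hx : k + a.numNodes < x) :
    leftLeaves (labelFrom k (.node u a b)) x =
        leftLeaves (labelFrom (k + a.numNodes + 1) b) x ∧
      rightLeaves (labelFrom k (.node u a b)) x =
        rightLeaves (labelFrom (k + a.numNodes + 1) b) x := by
  have h := leaves_eq_zero k a x (by omega)
  have h5 : x ≠ k + a.numNodes := by omega
  simp [labelFrom, leftLeaves, rightLeaves, h, h5]

theorem leaves_labelFrom_root (k : ℕ) (u : Unit) (a b : BinaryTree Unit) :
    leftLeaves (labelFrom k (.node u a b)) (k + a.numNodes) = a.numNodes + 1 ∧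
      rightLeaves (labelFrom k (.node u a b)) (k + a.numNodes) = b.numNodes + 1 := by
  simp [labelFrom, leftLeaves, rightLeaves, numLeaves_labelFrom,
    ← BinaryTree.numLeaves_eq_numNodes_succ]

/-- Both sides of an internal vertex `z` carry a leaf, and all leaves below `z` are leaves of the
tree. -/
theorem leaves_bounds (k : ℕ) (T : BinaryTree Unit) {z : ℕ} (hz : k ≤ z)
    (hz' : z < k + T.numNodes) :
    0 < leftLeaves (labelFrom k T) z ∧ 0 < rightLeaves (labelFrom k T) z ∧
      k + leftLeaves (labelFrom k T) z ≤ z + 1 ∧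
      z + rightLeaves (labelFrom k T) z ≤ k + T.numNodes := by
  induction T generalizing k with
  | nil => simp at hz'; omega
  | node u a b iha ihb =>
    simp only [BinaryTree.numNodes] at hz' ⊢
    rcases lt_trichotomy z (k + a.numNodes) with h | rfl | h
    · rw [(leaves_labelFrom_left k u a b h).1, (leaves_labelFrom_left k u a b h).2]
      have := iha k hz h
      omega
    · rw [(leaves_labelFrom_root k u a b).1, (leaves_labelFrom_root k u a b).2]
      omega
    · rw [(leaves_labelFrom_right k u a b h).1, (leaves_labelFrom_right k u a b h).2]
      have := ihb (k + a.numNodes + 1) (by omega) (by omega)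
      omega

/-- The labels `x` such that the leaf just to the left of `x` and the leaf just to the right of `x`
both descend from the internal vertex `z`: the interval `(z - l_z, z + r_z)`. -/
def IsBelow (k : ℕ) (T : BinaryTree Unit) (x z : ℕ) : Prop :=
  z < x + leftLeaves (labelFrom k T) z ∧ x < z + rightLeaves (labelFrom k T) z

theorem isBelow_left (k : ℕ) (u : Unit) (a b : BinaryTree Unit) {x z : ℕ}
    (hz : z < k + a.numNodes) : IsBelow k (.node u a b) x z ↔ IsBelow k a x z := by
  unfold IsBelow
  rw [(leaves_labelFrom_left k u a b hz).1, (leaves_labelFrom_left k u a b hz).2]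

theorem isBelow_right (k : ℕ) (u : Unit) (a b : BinaryTree Unit) {x z : ℕ}
    (hz : k + a.numNodes < z) :
    IsBelow k (.node u a b) x z ↔ IsBelow (k + a.numNodes + 1) b x z := by
  unfold IsBelow
  rw [(leaves_labelFrom_right k u a b hz).1, (leaves_labelFrom_right k u a b hz).2]

theorem isBelow_root (k : ℕ) (u : Unit) (a b : BinaryTree Unit) {x : ℕ} :
    IsBelow k (.node u a b) x (k + a.numNodes) ↔
      k ≤ x ∧ x < k + (BinaryTree.node u a b).numNodes := by
  unfold IsBelow
  rw [(leaves_labelFrom_root k u a b).1, (leaves_labelFrom_root k u a b).2]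
  simp only [BinaryTree.numNodes]
  omega

theorem IsBelow.mem_range {k : ℕ} {T : BinaryTree Unit} {x z : ℕ} (h : IsBelow k T x z)
    (hz : k ≤ z) (hz' : z < k + T.numNodes) : k ≤ x ∧ x < k + T.numNodes := by
  have := leaves_bounds k T hz hz'
  unfold IsBelow at h
  omega

theorem isBelow_self {k : ℕ} {T : BinaryTree Unit} {z : ℕ} (hz : k ≤ z)
    (hz' : z < k + T.numNodes) : IsBelow k T z z := by
  have := leaves_bounds k T hz hz'
  unfold IsBelow
  omega

theorem IsBelow.trans {k : ℕ} {T : BinaryTree Unit} {x y z : ℕ} (hxy : IsBelow k T x y)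
    (hyz : IsBelow k T y z) (hz : k ≤ z) (hz' : z < k + T.numNodes) : IsBelow k T x z := by
  induction T generalizing k with
  | nil => simp at hz'; omega
  | node u a b iha ihb =>
    have hy := hyz.mem_range hz hz'
    have hx := hxy.mem_range hy.1 hy.2
    simp only [BinaryTree.numNodes] at hz'
    rcases lt_trichotomy z (k + a.numNodes) with h | rfl | h
    · rw [isBelow_left k u a b h] at hyz ⊢
      have hy' := hyz.mem_range hz h
      rw [isBelow_left k u a b hy'.2] at hxy
      exact iha hxy hyz hz h
    · rw [isBelow_root]
      exact hx
    · rw [isBelow_right k u a b h] at hyz ⊢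
      have hy' := hyz.mem_range (by omega) (by omega)
      rw [isBelow_right k u a b (by omega)] at hxy
      exact ihb hxy hyz (by omega) (by omega)

theorem IsChild.isBelow {k : ℕ} {T : BinaryTree Unit} {x y : ℕ}
    (h : IsChild (labelFrom k T) x y) : IsBelow k T x y := by
  induction T generalizing k with
  | nil => exact h.elim
  | node u a b iha ihb =>
    have hr := isChild_labelFrom _ _ _ _ h
    rcases h with ⟨rfl, -⟩ | h | h
    · exact (isBelow_root k u a b).2 hr.1
    · have h1 := isChild_labelFrom _ _ _ _ h
      exact (isBelow_left k u a b h1.2.1.2).2 (iha h)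
    · have h1 := isChild_labelFrom _ _ _ _ h
      exact (isBelow_right k u a b (by omega)).2 (ihb h)

/-- The descendants of the internal vertex `z` form the interval `(z - l_z, z + r_z)` of labels. -/
theorem reflTransGen_isChild_iff {k : ℕ} {T : BinaryTree Unit} {x z : ℕ} (hz : k ≤ z)
    (hz' : z < k + T.numNodes) :
    Relation.ReflTransGen (IsChild (labelFrom k T)) x z ↔ IsBelow k T x z := by
  constructor
  · intro h
    induction h using Relation.ReflTransGen.head_induction_on with
    | refl => exact isBelow_self hz hz'
    | head h _ ih => exact (IsChild.isBelow h).trans ih hz hz'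
  · intro h
    induction T generalizing k z with
    | nil => simp at hz'; omega
    | node u a b iha ihb =>
      have hl : ∀ {z : ℕ}, k ≤ z → z < k + a.numNodes → IsBelow k a x z →
          Relation.ReflTransGen (IsChild (labelFrom k (.node u a b))) x z := fun h1 h2 h3 =>
        Relation.ReflTransGen.mono (fun _ _ h => Or.inr (Or.inl h)) _ _ (iha h1 h2 h3)
      have hr : ∀ {z : ℕ}, k + a.numNodes < z → z < k + a.numNodes + 1 + b.numNodes →
          IsBelow (k + a.numNodes + 1) b x z →
          Relation.ReflTransGen (IsChild (labelFrom k (.node u a b))) x z := fun h1 h2 h3 =>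
        Relation.ReflTransGen.mono (fun _ _ h => Or.inr (Or.inr h)) _ _ (ihb h1 h2 h3)
      have hx := h.mem_range hz hz'
      simp only [BinaryTree.numNodes] at hz' hx
      rcases lt_trichotomy z (k + a.numNodes) with hza | rfl | hza
      · exact hl hz hza ((isBelow_left k u a b hza).1 h)
      · -- every vertex descends from the root of its subtree, and this root is a child of `z`
        rcases lt_trichotomy x (k + a.numNodes) with hxa | rfl | hxa
        · cases a with
          | nil => simp at hxa; omega
          | node u' a₁ a₂ =>
            refine (hl (z := k + a₁.numNodes) (by omega)
              (by simp only [BinaryTree.numNodes]; omega)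
              ((isBelow_root k u' a₁ a₂).2 ⟨hx.1, hxa⟩)).tail ?_
            exact Or.inl ⟨rfl, Or.inl rfl⟩
        · exact Relation.ReflTransGen.refl
        · cases b with
          | nil => simp at hx; omega
          | node u' b₁ b₂ =>
            refine (hr (z := k + a.numNodes + 1 + b₁.numNodes) (by omega)
              (by simp only [BinaryTree.numNodes]; omega)
              ((isBelow_root _ u' b₁ b₂).2 ⟨hxa, by omega⟩)).tail ?_
            exact Or.inl ⟨rfl, Or.inr rfl⟩
      · exact hr hza (by omega) ((isBelow_right k u a b hza).1 h)

theorem rootLabel_not_isChild {k : ℕ} {T : BinaryTree Unit} {x y : ℕ}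
    (hx : rootLabel (labelFrom k T) = some x) : ¬ IsChild (labelFrom k T) x y := by
  intro h
  have h1 := rootLabel_labelFrom _ _ _ hx
  have h2 := isChild_labelFrom _ _ _ _ h
  have h3 := leaves_bounds k T h2.2.1.1 h2.2.1.2
  have h4 := T.numLeaves_eq_numNodes_succ
  omega

theorem isChild_unique {k : ℕ} {T : BinaryTree Unit} {x y y' : ℕ}
    (h : IsChild (labelFrom k T) x y) (h' : IsChild (labelFrom k T) x y') : y = y' := by
  induction T generalizing k with
  | nil => exact h.elim
  | node u a b iha ihb =>
    have ra : ∀ {x}, rootLabel (labelFrom k a) = some x → _ := fun h => rootLabel_labelFrom _ _ _ h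
    have rb : ∀ {x}, rootLabel (labelFrom (k + a.numNodes + 1) b) = some x → _ :=
      fun h => rootLabel_labelFrom _ _ _ h
    have ca : ∀ {x y}, IsChild (labelFrom k a) x y → _ := fun h => isChild_labelFrom _ _ _ _ h
    have cb : ∀ {x y}, IsChild (labelFrom (k + a.numNodes + 1) b) x y → _ :=
      fun h => isChild_labelFrom _ _ _ _ h
    rcases h with ⟨rfl, h | h⟩ | h | h <;> rcases h' with ⟨rfl, h' | h'⟩ | h' | h'
    · rfl
    · rfl
    · exact (rootLabel_not_isChild h h').elim
    · have := ra h; have := cb h'; omega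
    · rfl
    · rfl
    · have := rb h; have := ca h'; omega
    · exact (rootLabel_not_isChild h h').elim
    · exact (rootLabel_not_isChild h' h).elim
    · have := ca h; have := rb h'; omega
    · exact iha h h'
    · have := ca h; have := cb h'; omega
    · have := cb h; have := ra h'; omega
    · exact (rootLabel_not_isChild h' h).elim
    · have := cb h; have := ca h'; omega
    · exact ihb h h'

/-- Each interval of labels contains a common ancestor of all its elements. -/
theorem exists_common_ancestor {k : ℕ} (T : BinaryTree Unit) {i j : ℕ} (hi : k ≤ i) (hij : i ≤ j)
    (hj : j < k + T.numNodes) : ∃ m, i ≤ m ∧ m ≤ j ∧ IsBelow k T i m ∧ IsBelow k T j m := by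
  induction T generalizing k with
  | nil => simp at hj; omega
  | node u a b iha ihb =>
    by_cases hja : j < k + a.numNodes
    · obtain ⟨m, h1, h2, h3⟩ := iha hi hja
      refine ⟨m, h1, h2, ?_⟩
      rwa [isBelow_left k u a b (by omega), isBelow_left k u a b (by omega)]
    by_cases hia : k + a.numNodes < i
    · simp only [BinaryTree.numNodes] at hj
      obtain ⟨m, h1, h2, h3⟩ := ihb (k := k + a.numNodes + 1) hia (by omega)
      refine ⟨m, h1, h2, ?_⟩
      rwa [isBelow_right k u a b (by omega), isBelow_right k u a b (by omega)]
    · refine ⟨k + a.numNodes, by omega, by omega, ?_⟩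
      rw [isBelow_root, isBelow_root]
      omega

/-- The decreasing tree of a function `y`: any function on an interval of labels is weakly
decreasing from parents to children for some tree. -/
theorem exists_decreasing_tree (y : ℕ → ℝ) (n k : ℕ) :
    ∃ T : BinaryTree Unit, T.numNodes = n ∧ ∀ x z, IsChild (labelFrom k T) x z → y x ≤ y z := by
  induction n using Nat.strong_induction_on generalizing k with
  | _ n ih =>
    rcases Nat.eq_zero_or_pos n with rfl | hn
    · exact ⟨.nil, rfl, fun _ _ h => h.elim⟩
    obtain ⟨c, hc, hmax⟩ := (Finset.Ico k (k + n)).exists_max_image y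
      (Finset.nonempty_Ico.2 (by omega))
    rw [Finset.mem_Ico] at hc
    obtain ⟨a, ha, hya⟩ := ih (c - k) (by omega) k
    obtain ⟨b, hb, hyb⟩ := ih (k + n - (c + 1)) (by omega) (c + 1)
    have hca : k + a.numNodes = c := by omega
    refine ⟨.node () a b, by simp only [BinaryTree.numNodes]; omega, fun x z h => ?_⟩
    have hr := isChild_labelFrom _ _ _ _ h
    simp only [BinaryTree.numNodes] at hr
    rcases h with ⟨rfl, -⟩ | h | h
    · rw [hca]
      exact hmax x (Finset.mem_Ico.2 (by omega))
    · exact hya x z h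
    · rw [hca] at h
      exact hyb x z h

/-- A tree is determined by its numbers of left and right leaves: the root is the only internal
vertex with all leaves below it. -/
theorem tree_ext {k : ℕ} {T T' : BinaryTree Unit} (hn : T.numNodes = T'.numNodes)
    (h : ∀ z, k ≤ z → z < k + T.numNodes →
      leftLeaves (labelFrom k T) z = leftLeaves (labelFrom k T') z ∧
        rightLeaves (labelFrom k T) z = rightLeaves (labelFrom k T') z) : T = T' := by
  induction T generalizing k T' with
  | nil =>
    cases T' with
    | nil => rfl
    | node => simp at hn
  | node u a b iha ihb =>
    cases T' with
    | nil => simp at hn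
    | node u' a' b' =>
      simp only [BinaryTree.numNodes] at hn h
      have hroot := h (k + a.numNodes) (by omega) (by omega)
      rw [(leaves_labelFrom_root k u a b).1, (leaves_labelFrom_root k u a b).2] at hroot
      have hc : a.numNodes = a'.numNodes := by
        rcases lt_trichotomy (k + a.numNodes) (k + a'.numNodes) with hlt | heq | hlt
        · rw [(leaves_labelFrom_left k u' a' b' hlt).1,
            (leaves_labelFrom_left k u' a' b' hlt).2] at hroot
          have := leaves_bounds k a' (by omega) hlt
          omega
        · omega
        · rw [(leaves_labelFrom_right k u' a' b' hlt).1,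
            (leaves_labelFrom_right k u' a' b' hlt).2] at hroot
          have := leaves_bounds (k + a'.numNodes + 1) b' (z := k + a.numNodes)
            (by omega) (by omega)
          omega
      congr 1
      · refine iha (k := k) hc fun z hz hz' => ?_
        have := h z hz (by omega)
        rwa [(leaves_labelFrom_left k u a b hz').1, (leaves_labelFrom_left k u a b hz').2,
          (leaves_labelFrom_left k u' a' b' (by omega)).1,
          (leaves_labelFrom_left k u' a' b' (by omega)).2] at this
      · refine ihb (k := k + a.numNodes + 1) (by omega) fun z hz hz' => ?_
        have := h z (by omega) (by omega)
        rwa [(leaves_labelFrom_right k u a b hz).1, (leaves_labelFrom_right k u a b hz).2,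
          (leaves_labelFrom_right k u' a' b' (by omega)).1,
          (leaves_labelFrom_right k u' a' b' (by omega)).2, ← hc] at this

theorem tree_eq_of_isBelow_iff {k : ℕ} {T T' : BinaryTree Unit} (hn : T.numNodes = T'.numNodes)
    (h : ∀ x z, k ≤ x → x < k + T.numNodes → k ≤ z → z < k + T.numNodes →
      (IsBelow k T x z ↔ IsBelow k T' x z)) : T = T' := by
  refine tree_ext (k := k) hn fun z hz hz' => ?_
  have b := leaves_bounds k T hz hz'
  have b' := leaves_bounds k T' hz (hn ▸ hz')
  unfold IsBelow at h
  -- compare the two intervals of descendants at their respective end points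
  have h1 := h (z + 1 - leftLeaves (labelFrom k T) z) z (by omega) (by omega) hz hz'
  have h2 := h (z + 1 - leftLeaves (labelFrom k T') z) z (by omega) (by omega) hz hz'
  have h3 := h (z + rightLeaves (labelFrom k T) z - 1) z (by omega) (by omega) hz hz'
  have h4 := h (z + rightLeaves (labelFrom k T') z - 1) z (by omega) (by omega) hz hz'
  omega

end Descendants

/-! ### Tree posets on a linearly ordered set -/

section TreePosets

variable {I : Type*} [Fintype I] [LinearOrder I]

theorem rank_strictMono : StrictMono (rank : I → ℕ) := by
  intro i j hij
  refine Finset.card_lt_card (Finset.ssubset_iff_of_subset ?_ |>.mpr ⟨i, by simpa, by simp⟩)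
  intro k hk
  simp only [Finset.mem_filter, Finset.mem_univ, true_and] at hk ⊢
  exact hk.trans hij

theorem rank_lt_card (i : I) : rank i < Fintype.card I :=
  Finset.card_lt_card (Finset.filter_ssubset.2 ⟨i, Finset.mem_univ i, lt_irrefl i⟩)

theorem image_rank : (Finset.univ : Finset I).image rank = Finset.range (Fintype.card I) := by
  refine Finset.eq_of_subset_of_card_le (fun m hm => ?_) ?_
  · obtain ⟨i, -, rfl⟩ := Finset.mem_image.1 hm
    exact Finset.mem_range.2 (rank_lt_card i)
  · rw [Finset.card_image_of_injective _ rank_injective, Finset.card_range, Finset.card_univ]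

theorem exists_rank_eq {m : ℕ} (hm : m < Fintype.card I) : ∃ i : I, rank i = m := by
  have h : m ∈ (Finset.univ : Finset I).image rank := by
    rw [image_rank]
    exact Finset.mem_range.2 hm
  obtain ⟨i, -, hi⟩ := Finset.mem_image.1 h
  exact ⟨i, hi⟩

theorem card_filter_rank_mem {s : Finset ℕ} (hs : s ⊆ Finset.range (Fintype.card I)) :
    (Finset.univ.filter fun i : I => rank i ∈ s).card = s.card := by
  rw [← Finset.card_image_of_injective _ (rank_injective (I := I))]
  congr 1
  ext m
  simp only [Finset.mem_image, Finset.mem_filter, Finset.mem_univ, true_and]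
  constructor
  · rintro ⟨i, hi, rfl⟩
    exact hi
  · intro hm
    obtain ⟨i, rfl⟩ := exists_rank_eq (I := I) (Finset.mem_range.1 (hs hm))
    exact ⟨i, hm, rfl⟩

variable {T : BinaryTree Unit}

theorem treePoset_le_iff (hT : T.numNodes = Fintype.card I) (i j : I) :
    (treePoset T).le j i ↔ IsBelow 0 T (rank i) (rank j) :=
  reflTransGen_isChild_iff (Nat.zero_le _) (by rw [zero_add, hT]; exact rank_lt_card j)

/-- The number of leaves below an internal vertex decreases strictly along the tree poset. -/
theorem leaves_lt_of_descendant {x z : ℕ}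
    (h : Relation.ReflTransGen (IsChild (searchLabelling T)) x z) (hne : x ≠ z) :
    leftLeaves (searchLabelling T) x + rightLeaves (searchLabelling T) x <
      leftLeaves (searchLabelling T) z + rightLeaves (searchLabelling T) z := by
  induction h with
  | refl => exact absurd rfl hne
  | @tail b c _ hbc ih =>
    have h1 := (isChild_labelFrom 0 T _ _ hbc).2.2
    rcases eq_or_ne x b with rfl | hxb
    · exact h1
    · exact (ih hxb).trans h1

theorem treePoset_injOn :
    Set.InjOn (treePoset : BinaryTree Unit → PartialOrder I) (treesOn I) := by
  intro T hT T' hT' h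
  rw [Finset.mem_coe, BinaryTree.mem_treesOfNumNodesEq] at hT hT'
  refine tree_eq_of_isBelow_iff (k := 0) (hT.trans hT'.symm) fun x z _ hx _ hz => ?_
  rw [zero_add, hT] at hx hz
  obtain ⟨i, rfl⟩ := exists_rank_eq (I := I) hx
  obtain ⟨j, rfl⟩ := exists_rank_eq (I := I) hz
  rw [← treePoset_le_iff hT, ← treePoset_le_iff hT', h]

/-- `m` is the minimum of the interval `q = [q.1, q.2]` of `I` for the tree poset, that is, the
lowest common ancestor of `q.1` and `q.2` in the tree. -/
def IsTop (T : BinaryTree Unit) (q : I × I) (m : I) : Prop :=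
  m ∈ Set.Icc q.1 q.2 ∧ ∀ k ∈ Set.Icc q.1 q.2, (treePoset T).le m k

theorem IsTop.unique {T : BinaryTree Unit} {q : I × I} {m m' : I} (h : IsTop T q m)
    (h' : IsTop T q m') : m = m' :=
  (treePoset T).le_antisymm _ _ (h.2 m' h'.1) (h'.2 m h.1)

/-- It suffices to test the end points, since the descendants of a vertex form an interval. -/
theorem isTop_treePoset_iff (hT : T.numNodes = Fintype.card I) (q : I × I) (m : I) :
    IsTop T q m ↔
      m ∈ Set.Icc q.1 q.2 ∧ (treePoset T).le m q.1 ∧ (treePoset T).le m q.2 := by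
  refine and_congr_right fun hm => ⟨fun h => ⟨h _ ⟨le_rfl, hm.1.trans hm.2⟩,
    h _ ⟨hm.1.trans hm.2, le_rfl⟩⟩, fun h k hk => ?_⟩
  rw [treePoset_le_iff hT, treePoset_le_iff hT] at h
  rw [treePoset_le_iff hT]
  have h1 := rank_strictMono.monotone hk.1
  have h2 := rank_strictMono.monotone hk.2
  unfold IsBelow at h ⊢
  omega

theorem exists_isTop (hT : T.numNodes = Fintype.card I) :
    ∃ top : I × I → I, ∀ q : I × I, q.1 ≤ q.2 → IsTop T q (top q) := by
  have h : ∀ q : I × I, ∃ m : I, q.1 ≤ q.2 → IsTop T q m := by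
    intro q
    by_cases hq : q.1 ≤ q.2
    · obtain ⟨m, h1, h2, h3⟩ := exists_common_ancestor (k := 0) T (Nat.zero_le (rank q.1))
        (rank_strictMono.monotone hq) (by rw [zero_add, hT]; exact rank_lt_card _)
      obtain ⟨m, rfl⟩ := exists_rank_eq (I := I) (h2.trans_lt (rank_lt_card _))
      refine ⟨m, fun _ => (isTop_treePoset_iff hT q m).2
        ⟨⟨rank_strictMono.le_iff_le.1 h1, rank_strictMono.le_iff_le.1 h2⟩, ?_⟩⟩
      rwa [treePoset_le_iff hT, treePoset_le_iff hT]
    · exact ⟨q.1, fun h => absurd h hq⟩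
  choose top htop using h
  exact ⟨top, htop⟩

/-- The product `l_k r_k` counts the intervals whose end points have the lowest common ancestor
`k`: an end point on the left and one on the right can be chosen independently. -/
theorem lodayVertex_eq_sum (hT : T.numNodes = Fintype.card I) {top : I × I → I}
    (htop : ∀ q : I × I, q.1 ≤ q.2 → IsTop T q (top q)) :
    (lodayVertex T : I → ℝ) =
      ∑ q ∈ (Finset.univ : Finset (I × I)) with q.1 ≤ q.2, Pi.single (top q) 1 := by
  funext k
  have hb := leaves_bounds 0 T (Nat.zero_le (rank k))
    (by rw [zero_add, hT]; exact rank_lt_card k)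
  rw [zero_add, zero_add, hT] at hb
  set L := leftLeaves (labelFrom 0 T) (rank k) with hL
  set R := rightLeaves (labelFrom 0 T) (rank k) with hR
  have hset : ((Finset.univ : Finset (I × I)).filter fun q => q.1 ≤ q.2 ∧ k = top q) =
      (Finset.univ.filter fun i : I => rank i ∈ Finset.Ico (rank k + 1 - L) (rank k + 1)) ×ˢ
        (Finset.univ.filter fun i : I => rank i ∈ Finset.Ico (rank k) (rank k + R)) := by
    ext q
    simp only [Finset.mem_filter, Finset.mem_univ, true_and, Finset.mem_product, Finset.mem_Ico]
    have e : (q.1 ≤ q.2 ∧ k = top q) ↔ IsTop T q k :=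
      ⟨fun h => h.2 ▸ htop q h.1, fun h =>
        ⟨h.1.1.trans h.1.2, h.unique (htop q (h.1.1.trans h.1.2))⟩⟩
    rw [e, isTop_treePoset_iff hT, treePoset_le_iff hT, treePoset_le_iff hT, Set.mem_Icc,
      ← rank_strictMono.le_iff_le, ← rank_strictMono.le_iff_le (a := k)]
    unfold IsBelow
    rw [← hL, ← hR]
    omega
  have hc1 := card_filter_rank_mem (I := I) (s := Finset.Ico (rank k + 1 - L) (rank k + 1))
    fun m hm => by
      have := rank_lt_card k
      rw [Finset.mem_Ico] at hm
      exact Finset.mem_range.2 (by omega)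
  have hc2 := card_filter_rank_mem (I := I) (s := Finset.Ico (rank k) (rank k + R))
    fun m hm => by
      rw [Finset.mem_Ico] at hm
      exact Finset.mem_range.2 (by omega)
  rw [Nat.card_Ico] at hc1 hc2
  rw [Finset.sum_apply]
  simp only [Pi.single_apply]
  rw [Finset.sum_boole, Finset.filter_filter, hset, Finset.card_product, hc1, hc2,
    show rank k + 1 - (rank k + 1 - L) = L by omega, show rank k + R - rank k = R by omega,
    Nat.cast_mul]
  rfl

end TreePosets

/-! ### Functionals on poset cones, and segments in rays -/

section Cones

variable {I : Type*}

theorem apply_nonpos_of_mem_posetCone [DecidableEq I] {p : PartialOrder I}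
    {f : StrongDual ℝ (I → ℝ)}
    (h : ∀ i j : I, p.le j i → f (Pi.single i 1) ≤ f (Pi.single j 1)) {d : I → ℝ}
    (hd : d ∈ posetCone p) : f d ≤ 0 := by
  induction hd using Submodule.span_induction with
  | mem d hd =>
    obtain ⟨i, j, hij, rfl⟩ := hd
    rw [map_sub]
    exact sub_nonpos.2 (h i j hij)
  | zero => simp
  | add a b _ _ ha hb =>
    rw [map_add]
    linarith
  | smul r a _ ha =>
    have h1 : r • a = (r : ℝ) • a := rfl
    rw [h1, map_smul, smul_eq_mul]
    exact mul_nonpos_of_nonneg_of_nonpos r.2 ha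

/-- If a functional vanishes at `r` and each generator of a poset cone is a nonnegative multiple of
`r` or makes the functional negative, then the same holds for all elements of the cone. For `r = 0`
the functional exposes the apex, and for a generator `r` an extreme ray. -/
theorem neg_or_mem_ray_of_mem_posetCone [DecidableEq I] {p : PartialOrder I}
    {f : StrongDual ℝ (I → ℝ)}
    {r : I → ℝ} (hr : f r = 0)
    (h : ∀ i j : I, p.le j i → f (Pi.single i 1 - Pi.single j 1) < 0 ∨
      ∃ t : ℝ, 0 ≤ t ∧ (Pi.single i 1 - Pi.single j 1 : I → ℝ) = t • r)
    {d : I → ℝ} (hd : d ∈ posetCone p) : f d < 0 ∨ ∃ t : ℝ, 0 ≤ t ∧ d = t • r := by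
  induction hd using Submodule.span_induction with
  | mem d hd =>
    obtain ⟨i, j, hij, rfl⟩ := hd
    exact h i j hij
  | zero => exact Or.inr ⟨0, le_rfl, (zero_smul _ _).symm⟩
  | add a b _ _ ha hb =>
    rw [map_add]
    rcases ha with ha | ⟨s, hs, rfl⟩ <;> rcases hb with hb | ⟨t, ht, rfl⟩
    · left; linarith
    · left; rw [map_smul, hr, smul_zero]; linarith
    · left; rw [map_smul, hr, smul_zero]; linarith
    · exact Or.inr ⟨s + t, add_nonneg hs ht, (add_smul _ _ _).symm⟩
  | smul c a _ ha =>
    have h1 : c • a = (c : ℝ) • a := rfl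
    rw [h1]
    rcases ha with ha | ⟨s, hs, rfl⟩
    · rcases eq_or_lt_of_le c.2 with hc | hc
      · exact Or.inr ⟨0, le_rfl, by rw [← hc, zero_smul, zero_smul]⟩
      · left
        rw [map_smul, smul_eq_mul]
        exact mul_neg_of_pos_of_neg hc ha
    · exact Or.inr ⟨c * s, mul_nonneg c.2 hs, smul_smul _ _ _⟩

/-- A compact convex subset of a ray that contains the end point of the ray and is not a point is a
segment. -/
theorem exists_segment_eq_of_subset_ray {G : Set (I → ℝ)} (hGc : IsCompact G) (hG : Convex ℝ G)
    {v r : I → ℝ} {g : StrongDual ℝ (I → ℝ)} (hg : g r = 1) (hv : v ∈ G) (hvr : v + r ∈ G)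
    (hray : ∀ u ∈ G, ∃ t : ℝ, 0 ≤ t ∧ u - v = t • r) :
    ∃ s : ℝ, 0 < s ∧ segment ℝ v (v + s • r) = G := by
  obtain ⟨w, hw, hmax⟩ := hGc.exists_isMaxOn ⟨v, hv⟩ g.continuous.continuousOn
  obtain ⟨s, -, hs⟩ := hray w hw
  obtain rfl : w = v + s • r := by rw [← hs, add_sub_cancel]
  have hle : ∀ t : ℝ, v + t • r ∈ G → t ≤ s := by
    intro t ht
    have h : g (v + t • r) ≤ g (v + s • r) := hmax ht
    simpa [hg] using h
  have hs1 : 1 ≤ s := hle 1 (by rwa [one_smul])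
  refine ⟨s, by linarith, Set.Subset.antisymm (hG.segment_subset hv hw) fun u hu => ?_⟩
  obtain ⟨t, ht, htu⟩ := hray u hu
  obtain rfl : u = v + t • r := by rw [← htu, add_sub_cancel]
  rw [segment_eq_image']
  refine ⟨t / s, ⟨by positivity, (div_le_one (by linarith)).2 (hle t hu)⟩, ?_⟩
  simp only [add_sub_cancel_left, smul_smul]
  rw [div_mul_cancel₀ _ (by linarith)]

end Cones

/-! ### The associahedron near the point of a tree -/

section LocalStructure

variable {I : Type*} [Fintype I] [LinearOrder I] {T : BinaryTree Unit}

/-- The linear functional with coefficients `c`. -/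
noncomputable def weightFunctional (c : I → ℝ) : StrongDual ℝ (I → ℝ) :=
  ∑ i, c i • ContinuousLinearMap.proj i

theorem weightFunctional_single (c : I → ℝ) (i : I) :
    weightFunctional c (Pi.single i 1) = c i := by
  simp [weightFunctional, Pi.single_apply]

theorem lodayVertex_mem_associahedron (hT : T.numNodes = Fintype.card I) :
    lodayVertex T ∈ associahedron I := by
  obtain ⟨top, htop⟩ := exists_isTop hT
  rw [lodayVertex_eq_sum hT htop]
  refine Set.finsetSum_mem_finsetSum _ _ _ fun q hq => ?_
  exact subset_convexHull ℝ _ ⟨top q, (htop q (Finset.mem_filter.mp hq).2).1, rfl⟩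

/-- Each summand `conv {e_k : i ≤ k ≤ j}` is contained in the translate of the poset cone to the
vertex `e_m` chosen by the tree, because all `k` between `i` and `j` descend from `m`. -/
theorem sub_lodayVertex_mem_posetCone (hT : T.numNodes = Fintype.card I) {w : I → ℝ}
    (hw : w ∈ associahedron I) : w - lodayVertex T ∈ posetCone (treePoset T) := by
  obtain ⟨top, htop⟩ := exists_isTop hT
  obtain ⟨g, hg, rfl⟩ := (Set.mem_finsetSum _ _ _).mp hw
  rw [lodayVertex_eq_sum hT htop, ← Finset.sum_sub_distrib]
  refine Submodule.sum_mem _ fun q hq => ?_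
  have hm := htop q (Finset.mem_filter.mp hq).2
  have hc : Convex ℝ {u : I → ℝ | u - Pi.single (top q) 1 ∈ posetCone (treePoset T)} := by
    intro u hu u' hu' a b ha hb hab
    have h := Submodule.add_mem _
      (PointedCone.smul_mem (posetCone (treePoset T)) ha hu)
      (PointedCone.smul_mem (posetCone (treePoset T)) hb hu')
    rwa [smul_sub, smul_sub, sub_add_sub_comm, ← add_smul, hab, one_smul] at h
  refine convexHull_min ?_ hc (hg hq)
  rintro _ ⟨k, hk, rfl⟩
  exact PointedCone.subset_hull ⟨k, top q, hm.2 k hk, rfl⟩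

/-- The number of leaves below each internal vertex, as a functional, exposes the point of the
tree. -/
theorem lodayVertex_mem_vertices (hT : T.numNodes = Fintype.card I) :
    lodayVertex T ∈ vertices (associahedron I) := by
  set f : StrongDual ℝ (I → ℝ) := weightFunctional fun i => ((leftLeaves (searchLabelling T)
    (rank i) + rightLeaves (searchLabelling T) (rank i) : ℕ) : ℝ) with hf
  refine ⟨lodayVertex_mem_associahedron hT, f, fun w hw => ?_⟩
  have h := neg_or_mem_ray_of_mem_posetCone (map_zero f) (fun i j hij => ?_)
    (sub_lodayVertex_mem_posetCone hT hw)
  · rcases h with h | ⟨t, -, h⟩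
    · rw [map_sub] at h
      exact ⟨by linarith, fun h' => absurd h (by linarith)⟩
    · rw [smul_zero, sub_eq_zero] at h
      subst h
      exact ⟨le_rfl, fun _ => rfl⟩
  · rcases eq_or_ne i j with rfl | hne
    · exact Or.inr ⟨0, le_rfl, by simp⟩
    · left
      rw [map_sub, hf, weightFunctional_single, weightFunctional_single, sub_neg, Nat.cast_lt]
      exact leaves_lt_of_descendant hij fun h => hne (rank_injective h)

/-- A vertex exposed by `f` is the point of any decreasing tree of `f`. -/
theorem exists_lodayVertex_eq {v : I → ℝ} (hv : v ∈ vertices (associahedron I)) :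
    ∃ T : BinaryTree Unit, T.numNodes = Fintype.card I ∧ lodayVertex T = v := by
  obtain ⟨hvP, f, hf⟩ := hv
  set y : ℕ → ℝ := Function.extend rank (fun i : I => f (Pi.single i 1)) 0 with hy
  have hyr : ∀ i : I, y (rank i) = f (Pi.single i 1) := fun i =>
    rank_injective.extend_apply _ _ i
  obtain ⟨T, hT, hmono⟩ := exists_decreasing_tree y (Fintype.card I) 0
  refine ⟨T, hT, (hf _ (lodayVertex_mem_associahedron hT)).2 ?_⟩
  have h := apply_nonpos_of_mem_posetCone (f := f) (fun i j hij => ?_)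
    (sub_lodayVertex_mem_posetCone hT hvP)
  · rwa [map_sub, sub_nonpos] at h
  · rw [← hyr, ← hyr]
    have hchain : ∀ {x z : ℕ}, Relation.ReflTransGen (IsChild (searchLabelling T)) x z →
        y x ≤ y z := by
      intro x z h
      induction h with
      | refl => exact le_rfl
      | tail _ hbc ih => exact ih.trans (hmono _ _ hbc)
    exact hchain hij

/-- Replacing `e_z` by `e_x` in the summand of the interval between `z` and its child `x` stays in
the associahedron. -/
theorem lodayVertex_add_mem_associahedron (hT : T.numNodes = Fintype.card I) {x z : I}
    (hxz : (treePoset T).le z x) :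
    lodayVertex T + (Pi.single x 1 - Pi.single z 1) ∈ associahedron I := by
  obtain ⟨top, htop⟩ := exists_isTop hT
  have hle : min x z ≤ max x z := min_le_max
  have hz : top (min x z, max x z) = z := by
    refine (htop (min x z, max x z) hle).unique
      ((isTop_treePoset_iff hT _ _).2 ⟨⟨min_le_right _ _, le_max_right _ _⟩, ?_⟩)
    rcases le_total x z with h | h
    · simpa [h] using ⟨hxz, (treePoset T).le_refl z⟩
    · simpa [h] using ⟨(treePoset T).le_refl z, hxz⟩
  have e : lodayVertex T + (Pi.single x 1 - Pi.single z 1 : I → ℝ) =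
      ∑ q ∈ (Finset.univ : Finset (I × I)) with q.1 ≤ q.2, (Pi.single (top q) 1 +
        if q = (min x z, max x z) then (Pi.single x 1 - Pi.single z 1 : I → ℝ) else 0) := by
    rw [Finset.sum_add_distrib, ← lodayVertex_eq_sum hT htop, Finset.sum_ite_eq', if_pos]
    exact Finset.mem_filter.2 ⟨Finset.mem_univ _, hle⟩
  rw [e]
  refine Set.finsetSum_mem_finsetSum _ _ _ fun q hq => subset_convexHull ℝ _ ?_
  split_ifs with h
  · subst h
    rw [hz, add_sub_cancel]
    exact ⟨x, ⟨min_le_left _ _, le_max_left _ _⟩, rfl⟩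
  · rw [add_zero]
    exact ⟨top q, (htop q (Finset.mem_filter.mp hq).2).1, rfl⟩

/-- Each pair of a vertex `z` of the tree and a child `x` of it gives an edge. It is exposed by the
functional that counts the leaves below each internal vertex, with the value at `x` raised to the
value at `z`: this keeps strict all relations of the poset except the one between `x` and `z`. -/
theorem single_sub_single_mem_vertexCone_of_isChild (hT : T.numNodes = Fintype.card I) {x z : I}
    (hxz : IsChild (searchLabelling T) (rank x) (rank z)) :
    (Pi.single x 1 - Pi.single z 1 : I → ℝ) ∈
      vertexCone (associahedron I) (lodayVertex T) := by
  set c : I → ℝ := fun i => ((leftLeaves (searchLabelling T) (rank i) +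
    rightLeaves (searchLabelling T) (rank i) : ℕ) : ℝ) with hc
  have hlt : ∀ i j, (treePoset T).le j i → i ≠ j → c i < c j := fun i j hij hne =>
    Nat.cast_lt.2 (leaves_lt_of_descendant hij fun h => hne (rank_injective h))
  have hle : (treePoset T).le z x := Relation.ReflTransGen.single hxz
  have hne : x ≠ z := by
    rintro rfl
    exact lt_irrefl _ (isChild_labelFrom _ _ _ _ hxz).2.2
  set f : StrongDual ℝ (I → ℝ) := weightFunctional (Function.update c x (c z)) with hf
  have hfx : f (Pi.single x 1) = c z := by rw [hf, weightFunctional_single, Function.update_self]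
  have hfi : ∀ i, i ≠ x → f (Pi.single i 1) = c i := fun i hi => by
    rw [hf, weightFunctional_single, Function.update_of_ne hi]
  set r : I → ℝ := Pi.single x 1 - Pi.single z 1 with hr
  have hfr : f r = 0 := by rw [hr, map_sub, hfx, hfi z hne.symm, sub_self]
  have hcone : ∀ w ∈ associahedron I, f (w - lodayVertex T) < 0 ∨
      ∃ t : ℝ, 0 ≤ t ∧ w - lodayVertex T = t • r := by
    intro w hw
    refine neg_or_mem_ray_of_mem_posetCone hfr (fun i j hij => ?_)
      (sub_lodayVertex_mem_posetCone hT hw)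
    rcases eq_or_ne i j with rfl | hij'
    · exact Or.inr ⟨0, le_rfl, by simp⟩
    rw [map_sub, sub_neg]
    rcases eq_or_ne i x with rfl | hi
    · rcases eq_or_ne j z with rfl | hj
      · exact Or.inr ⟨1, zero_le_one, (one_smul _ _).symm⟩
      · left
        rw [hfx, hfi j hij'.symm]
        -- a proper ancestor of `x` is an ancestor of its parent `z`
        refine hlt z j ?_ hj.symm
        rcases Relation.ReflTransGen.cases_head hij with h | ⟨y, hy, h⟩
        · exact absurd (rank_injective h) hij'
        · obtain rfl : y = rank z := isChild_unique hy hxz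
          exact h
    · left
      rw [hfi i hi]
      rcases eq_or_ne j x with rfl | hj
      · rw [hfx]
        exact (hlt i _ hij hij').trans (hlt _ z hle hne)
      · rw [hfi j hj]
        exact hlt i j hij hij'
  have hfle : ∀ w ∈ associahedron I, f w ≤ f (lodayVertex T) := by
    intro w hw
    rcases hcone w hw with h | ⟨t, -, h⟩
    · rw [map_sub] at h
      linarith
    · have h' := congrArg f h
      rw [map_sub, map_smul, hfr, smul_zero] at h'
      linarith
  have hPc : IsCompact (associahedron I) ∧ Convex ℝ (associahedron I) := by
    obtain ⟨s, hs, h⟩ := isPolytope_associahedron I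
    rw [h]
    exact ⟨hs.isCompact_convexHull (𝕜 := ℝ), convex_convexHull ℝ s⟩
  have hGe : IsExposed ℝ (associahedron I) (f.toExposed (associahedron I)) :=
    ContinuousLinearMap.toExposed.isExposed
  obtain ⟨s, hs, hseg⟩ := exists_segment_eq_of_subset_ray (hGe.isCompact hPc.1) (hGe.convex hPc.2)
    (v := lodayVertex T) (r := r) (g := ContinuousLinearMap.proj x) (by simp [hr, hne])
    ⟨lodayVertex_mem_associahedron hT, hfle⟩
    ⟨lodayVertex_add_mem_associahedron hT hle, fun w hw => by
      rw [map_add, hfr, add_zero]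
      exact hfle w hw⟩
    (fun u hu => (hcone u hu.1).resolve_left fun h => by
      have := hu.2 _ (lodayVertex_mem_associahedron hT)
      rw [map_sub] at h
      linarith)
  have hrne : r ≠ 0 := fun h => by
    have := congrFun h x
    simp [hr, hne] at this
  have hmem : s • r ∈ vertexCone (associahedron I) (lodayVertex T) := by
    refine PointedCone.subset_hull ⟨lodayVertex T + s • r, ?_, ?_, ?_⟩
    · simpa using ⟨hs.ne', hrne⟩
    · rw [hseg]
      exact hGe
    · rw [add_sub_cancel_left]
  have h := PointedCone.smul_mem _ (inv_nonneg.2 hs.le) hmem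
  rwa [smul_smul, inv_mul_cancel₀ hs.ne', one_smul] at h

theorem vertexCone_lodayVertex (hT : T.numNodes = Fintype.card I) :
    vertexCone (associahedron I) (lodayVertex T) = posetCone (treePoset T) := by
  refine le_antisymm (Submodule.span_le.2 ?_) (Submodule.span_le.2 ?_)
  · rintro d ⟨w, -, hF, rfl⟩
    exact sub_lodayVertex_mem_posetCone hT (hF.subset (right_mem_segment ℝ _ w))
  · rintro d ⟨i, j, hij, rfl⟩
    -- add up the generators of the parent-child pairs on the path from `i` to `j`
    have hchain : ∀ {m : ℕ}, Relation.ReflTransGen (IsChild (searchLabelling T)) (rank i) m →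
        ∀ k : I, rank k = m → (Pi.single i 1 - Pi.single k 1 : I → ℝ) ∈
          vertexCone (associahedron I) (lodayVertex T) := by
      intro m h
      induction h with
      | refl =>
        intro k hk
        rw [rank_injective hk, sub_self]
        exact Submodule.zero_mem _
      | @tail b _ _ hbc ih =>
        rintro k rfl
        have hb := (isChild_labelFrom _ _ _ _ hbc).1.2
        rw [zero_add, hT] at hb
        obtain ⟨b, rfl⟩ := exists_rank_eq (I := I) hb
        have h := Submodule.add_mem _ (ih b rfl)
          (single_sub_single_mem_vertexCone_of_isChild hT hbc)
        rwa [sub_add_sub_cancel] at h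
    exact hchain hij j rfl

theorem lodayVertex_bijOn :
    Set.BijOn (lodayVertex : BinaryTree Unit → I → ℝ) (treesOn I)
      (vertices (associahedron I)) := by
  refine ⟨fun T hT => ?_, fun T hT T' hT' h => treePoset_injOn hT hT' ?_, fun v hv => ?_⟩
  · exact lodayVertex_mem_vertices (BinaryTree.mem_treesOfNumNodesEq.1 hT)
  · have h1 := vertexCone_lodayVertex (BinaryTree.mem_treesOfNumNodesEq.1 hT)
    have h2 := vertexCone_lodayVertex (BinaryTree.mem_treesOfNumNodesEq.1 hT')
    rw [h, h2] at h1
    refine PartialOrder.ext fun a b => ?_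
    rw [← mem_posetCone_iff (treePoset T) b a, ← h1, mem_posetCone_iff (treePoset T') b a]
  · obtain ⟨T, hT, rfl⟩ := exists_lodayVertex_eq hv
    exact ⟨T, BinaryTree.mem_treesOfNumNodesEq.2 hT, rfl⟩

/-- The sum over the vertices, for a parametrization of the vertices with known vertex cones. -/
theorem vertexPosetSum_eq_sum (K : Type*) [Field K] (P : GP I) {ι : Type*} {s : Finset ι}
    {f : ι → I → ℝ} {p : ι → PartialOrder I} (hf : Set.BijOn f s (vertices P.1))
    (hp : ∀ t ∈ s, vertexCone P.1 (f t) = posetCone (p t)) :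
    vertexPosetSum K P = ∑ t ∈ s, Finsupp.single (p t) 1 := by
  symm
  refine Finset.sum_bij (fun t ht => ⟨f t, hf.mapsTo ht⟩) (fun _ _ => Finset.mem_univ _)
    (fun t ht t' ht' h => hf.injOn ht ht' (congrArg Subtype.val h)) (fun v _ => ?_)
    (fun t ht => ?_)
  · obtain ⟨t, ht, h⟩ := hf.surjOn v.2
    exact ⟨t, ht, Subtype.ext h⟩
  · rw [vertexPoset_eq_of_cone _ (hp t ht)]

end LocalStructure

end BrionMap

theorem mainTheorem5 (K : Type*) [Field K] [CharZero K] (I : Type*) [Fintype I] [LinearOrder I] :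
    Set.BijOn (BrionMap.lodayVertex : BinaryTree Unit → I → ℝ) (BrionMap.treesOn I)
        (BrionMap.vertices (BrionMap.associahedron I)) ∧
      (∀ T ∈ BrionMap.treesOn I,
        BrionMap.vertexCone (BrionMap.associahedron I) (BrionMap.lodayVertex T) =
            BrionMap.posetCone (BrionMap.treePoset T) ∧
          ∀ hv : BrionMap.lodayVertex T ∈ BrionMap.vertices (BrionMap.associahedron I),
            BrionMap.vertexPoset (BrionMap.associahedron I) (BrionMap.lodayVertex T) hv =
              BrionMap.treePoset T) ∧
      BrionMap.brion K (BrionMap.associahedronClass I K) =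
        ∑ p ∈ BrionMap.RBT I, Finsupp.single p 1 := by
  have hcone : ∀ T ∈ BrionMap.treesOn I,
      BrionMap.vertexCone (BrionMap.associahedron I) (BrionMap.lodayVertex T) =
        BrionMap.posetCone (BrionMap.treePoset T) := fun T hT =>
    BrionMap.vertexCone_lodayVertex (BinaryTree.mem_treesOfNumNodesEq.1 hT)
  have hbij := BrionMap.lodayVertex_bijOn (I := I)
  refine ⟨hbij, fun T hT => ⟨hcone T hT, fun hv =>
    BrionMap.vertexPoset_eq_of_cone hv (hcone T hT)⟩, ?_⟩
  classical
  rw [BrionMap.RBT, Finset.sum_image BrionMap.treePoset_injOn, BrionMap.associahedronClass,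
    BrionMap.brion, Finsupp.linearCombination_single, one_smul, Quotient.lift_mk]
  exact BrionMap.vertexPosetSum_eq_sum K _ hbij hcone
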